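/- Let $(L,o)$ be an oriented link in the thickened annulus $A\times I$, given by a diagram $\mathcal P(L)\subset A\subset S^2-\{\mathbb O,\mathbb X\}$, where $\mathbb X$ and $\mathbb O$ are basepoints at the inner and outer boundary circles of $A$; let $\overline o$ be the opposite orientation of all components. Let $(\mathcal C,\partial^{Lee})$ be the Lee complex over $\mathbb C$ of $\mathcal P(L)$, regarded as a diagram in $\mathbb R^2=S^2-\{\mathbb O\}$. It has a distinguished basis: the complete resolutions of $\mathcal P(L)$ with every circle marked $v_+$ or $v_-$. Each basis element has a quantum grading $j$ (depending on $o$ only through the numbers of positive and negative crossings) and an annular grading $k$, which is the number of circles marked $v_+$ minus the number of circles marked $v_-$, counting only the circles that separate $\mathbb X$ from $\mathbb O$. For $t\in[0,2]$ put $j_t=j-t\,k$, and let $\mathcal F_a\subset\mathcal C$ be the span of the basis elements with $j_t\ge a$. For a nonzero chain $x$ let $\mathrm{gr}_{j_t}(x)=\max\{a : x\in\mathcal F_a\}$, and for a nonzero class $\eta\in H_*(\mathcal C,\partial^{Lee})$ let $\mathrm{gr}_{j_t}(\eta)=\max\{\mathrm{gr}_{j_t}(x) : x \text{ a cycle with }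 [x]=\eta\}$. Let $\mathfrak s_o$ be Lee's canonical cycle: the oriented resolution of $(\mathcal P(L),o)$ in which a circle is labelled by $\mathbf a=v_-+v_+$ or $\mathbf b=v_--v_+$ according to whether the number of circles separating it from $\mathbb O$, plus $1$ if it is oriented counterclockwise, is even or odd. Put $d_t(L,o)=\mathrm{gr}_{j_t}([\mathfrak s_o])$. Then, for every $t\in[0,2]$, the classes $[\mathfrak s_o]$ and $[\mathfrak s_{\overline o}]$ are nonzero and $$d_t(L,o)=d_t(L,\overline o)=\min\{\mathrm{gr}_{j_t}(\eta) : \eta\in\mathrm{Span}_{\mathbb C}\{[\mathfrak s_o],[\mathfrak s_{\overline o}]\},\ \eta\ne 0\}.$$ -/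

import Mathlib

/-!
# Annular link diagrams and their Lee complexes

The annulus is drawn in the plane with polar coordinates, with the basepoint `X` at the centre and
the basepoint `O` at infinity.  A generic diagram of an annular link is cut by finitely many radial
arcs into sectors, each of which contains at most one crossing or one extremum of the
angular coordinate.  On every radial arc the strands are numbered `0, 1, 2, ...` starting from the
outer end (the end nearest to `O`).  Sectors are traversed counterclockwise.
-/

/-- What happens in one sector, from its first (incoming) radial arc to its second (outgoing) one.
In `cross q pos` the strands `q` and `q + 1` cross; `pos` tells whether the crossing is positive
when both strands are oriented counterclockwise around `X`.  In `birth q` two new strands `q` and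
`q + 1` appear, joined to one another; in `death q` the strands `q` and `q + 1` are joined and
disappear; `turnback q` is `death q` followed by `birth q`. -/
inductive AnnularPiece where
  | straight
  | cross (q : ℕ) (pos : Bool)
  | turnback (q : ℕ)
  | birth (q : ℕ)
  | death (q : ℕ)

namespace AnnularPiece

/-- The piece can be drawn between `m` incoming and `n` outgoing strands. -/
def Fits : AnnularPiece → ℕ → ℕ → Prop
  | straight, m, n => n = m
  | cross q _, m, n => q + 1 < m ∧ n = m
  | turnback q, m, n => q + 1 < m ∧ n = m
  | birth q, m, n => q ≤ m ∧ n = m + 2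
  | death q, m, n => q ≤ n ∧ m = n + 2

/-- The incoming strand `p` runs through the sector and leaves it as the outgoing strand `p'`. -/
def Through : AnnularPiece → ℕ → ℕ → Prop
  | straight, p, p' => p' = p
  | cross q _, p, p' =>
      (p = q ∧ p' = q + 1) ∨ (p = q + 1 ∧ p' = q) ∨ (p ≠ q ∧ p ≠ q + 1 ∧ p' = p)
  | turnback q, p, p' => p ≠ q ∧ p ≠ q + 1 ∧ p' = p
  | birth q, p, p' => (p < q ∧ p' = p) ∨ (q ≤ p ∧ p' = p + 2)
  | death q, p, p' => (p' < q ∧ p = p') ∨ (q ≤ p' ∧ p = p' + 2)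

/-- The incoming strands `p` and `p'` are joined to one another in the sector. -/
def TurnsIn : AnnularPiece → ℕ → ℕ → Prop
  | turnback q, p, p' => p = q ∧ p' = q + 1
  | death q, p, p' => p = q ∧ p' = q + 1
  | _, _, _ => False

/-- The outgoing strands `p` and `p'` are joined to one another in the sector. -/
def TurnsOut : AnnularPiece → ℕ → ℕ → Prop
  | turnback q, p, p' => p = q ∧ p' = q + 1
  | birth q, p, p' => p = q ∧ p' = q + 1
  | _, _, _ => False

def IsCrossing : AnnularPiece → Prop
  | cross _ _ => True
  | _ => False

/-- The number `q` of the outer one of the two strands that meet at a crossing. -/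
def index : AnnularPiece → ℕ
  | cross q _ => q
  | _ => 0

/-- The flag `pos` of a crossing. -/
def handed : AnnularPiece → Bool
  | cross _ pos => pos
  | _ => false

/-- The `0`-smoothing (`b = false`) or `1`-smoothing (`b = true`) of a crossing.  The `0`-smoothing
of a positive crossing is the smoothing that respects the orientations, and so is the
`1`-smoothing of a negative crossing. -/
def smooth (b : Bool) : AnnularPiece → AnnularPiece
  | cross q pos => if b = pos then turnback q else straight
  | e => e

theorem IsCrossing.eq_cross {e : AnnularPiece} (h : e.IsCrossing) :
    e = cross e.index e.handed := by
  cases e <;> simp_all [IsCrossing, index, handed]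

theorem IsCrossing.fits {e : AnnularPiece} (h : e.IsCrossing) {m n : ℕ} (hf : e.Fits m n) :
    e.index + 1 < m ∧ n = m := by
  rw [h.eq_cross] at hf
  exact hf

theorem Through.near {e : AnnularPiece} (he : ¬ e.IsCrossing) {p p' : ℕ} (h : e.Through p p') :
    p' = p ∨ p' = p + 2 ∨ p = p' + 2 := by
  cases e <;> simp only [Through, IsCrossing, not_true_eq_false] at h he <;> omega

theorem TurnsIn.next {e : AnnularPiece} {p p' : ℕ} (h : e.TurnsIn p p') : p' = p + 1 := by
  cases e <;> simp only [TurnsIn] at h <;> omega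

theorem TurnsOut.next {e : AnnularPiece} {p p' : ℕ} (h : e.TurnsOut p p') : p' = p + 1 := by
  cases e <;> simp only [TurnsOut] at h <;> omega

end AnnularPiece

/-- A diagram of a link in the thickened annulus.  The radial arcs are numbered cyclically by
`Fin (len + 1)`; the sector `s` lies between the radial arcs `s` and `s + 1`, and the sector `len`
ends at the radial arc `0`. -/
structure AnnularDiagram where
  len : ℕ
  width : Fin (len + 1) → ℕ
  piece : Fin (len + 1) → AnnularPiece
  fits : ∀ s, (piece s).Fits (width s) (width (s + 1))

namespace AnnularDiagram

variable (D : AnnularDiagram)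

/-- The intersection points of the diagram with the radial arcs. -/
abbrev Point : Type := Σ s : Fin (D.len + 1), Fin (D.width s)

/-- The crossings of the diagram, ordered by their sectors. -/
abbrev Crossing : Type := {s : Fin (D.len + 1) // (D.piece s).IsCrossing}

/-- The incoming end of the outer strand at a crossing. -/
def inOuter (c : D.Crossing) : D.Point :=
  ⟨c.1, (D.piece c.1).index, by have := (c.2.fits (D.fits c.1)).1; omega⟩

/-- The incoming end of the inner strand at a crossing. -/
def inInner (c : D.Crossing) : D.Point :=
  ⟨c.1, (D.piece c.1).index + 1, (c.2.fits (D.fits c.1)).1⟩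

/-- The outgoing inner end at a crossing. -/
def outInner (c : D.Crossing) : D.Point :=
  ⟨c.1 + 1, (D.piece c.1).index + 1, by have := c.2.fits (D.fits c.1); omega⟩

/-! ### Orientations -/

/-- An orientation of the link: `dir a` tells whether the strand through the point `a` runs
counterclockwise around `X` there. -/
structure Orientation where
  dir : D.Point → Bool
  dir_through : ∀ s (p : Fin (D.width s)) (p' : Fin (D.width (s + 1))),
    (D.piece s).Through p p' → dir ⟨s + 1, p'⟩ = dir ⟨s, p⟩
  dir_turnsIn : ∀ s (p p' : Fin (D.width s)),
    (D.piece s).TurnsIn p p' → dir ⟨s, p'⟩ = !dir ⟨s, p⟩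
  dir_turnsOut : ∀ s (p p' : Fin (D.width (s + 1))),
    (D.piece s).TurnsOut p p' → dir ⟨s + 1, p'⟩ = !dir ⟨s + 1, p⟩

/-- The opposite orientation (of all components). -/
def Orientation.reverse {D : AnnularDiagram} (o : D.Orientation) : D.Orientation where
  dir a := !o.dir a
  dir_through s p p' h := by rw [o.dir_through s p p' h]
  dir_turnsIn s p p' h := by rw [o.dir_turnsIn s p p' h]
  dir_turnsOut s p p' h := by rw [o.dir_turnsOut s p p' h]

/-- Whether a crossing is positive: reversing one of its two strands changes the sign. -/
def Orientation.isPositive {D : AnnularDiagram} (o : D.Orientation) (c : D.Crossing) : Bool :=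
  (D.piece c.1).handed == (o.dir (D.inOuter c) == o.dir (D.inInner c))

/-- The number of positive crossings. -/
noncomputable def Orientation.nPos {D : AnnularDiagram} (o : D.Orientation) : ℕ :=
  Nat.card {c : D.Crossing // o.isPositive c = true}

/-- The number of negative crossings. -/
noncomputable def Orientation.nNeg {D : AnnularDiagram} (o : D.Orientation) : ℕ :=
  Nat.card {c : D.Crossing // o.isPositive c = false}

/-! ### The cube of resolutions -/

/-- A vertex of the cube of resolutions: the choice of a smoothing of every crossing. -/
abbrev Vertex : Type := D.Crossing → Bool

open Classical in
/-- The sectors of the complete resolution at the vertex `r`. -/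
noncomputable def resolved (r : D.Vertex) (s : Fin (D.len + 1)) : AnnularPiece :=
  (D.piece s).smooth (if h : (D.piece s).IsCrossing then r ⟨s, h⟩ else false)

/-- Two points are joined by an arc of the complete resolution at `r` inside one sector. -/
inductive Joined (r : D.Vertex) : D.Point → D.Point → Prop
  | through (s : Fin (D.len + 1)) (p : Fin (D.width s)) (p' : Fin (D.width (s + 1))) :
      (D.resolved r s).Through p p' → Joined r ⟨s, p⟩ ⟨s + 1, p'⟩
  | turnsIn (s : Fin (D.len + 1)) (p p' : Fin (D.width s)) :
      (D.resolved r s).TurnsIn p p' → Joined r ⟨s, p⟩ ⟨s, p'⟩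
  | turnsOut (s : Fin (D.len + 1)) (p p' : Fin (D.width (s + 1))) :
      (D.resolved r s).TurnsOut p p' → Joined r ⟨s + 1, p⟩ ⟨s + 1, p'⟩

/-- The circles of the complete resolution at `r`. -/
def Circle (r : D.Vertex) : Type := Quot (D.Joined r)

/-- The circle through a point. -/
def circleOf (r : D.Vertex) (a : D.Point) : D.Circle r := Quot.mk _ a

instance (r : D.Vertex) : Finite (D.Circle r) := inferInstanceAs (Finite (Quot _))

noncomputable instance (r : D.Vertex) : Fintype (D.Circle r) := Fintype.ofFinite _

noncomputable instance : Fintype D.Crossing := Fintype.ofFinite _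

open Classical in
noncomputable instance (r : D.Vertex) : DecidableEq (D.Circle r) := fun _ _ => inferInstance

/-- The distinguished generators of the complex: complete resolutions with a marking of every circle
by `v₊` (`true`) or `v₋` (`false`). -/
abbrev Generator : Type := Σ r : D.Vertex, (D.Circle r → Bool)

noncomputable instance : Fintype D.Generator := Fintype.ofFinite _

variable {D} in
/-- The marking of the circle through a point. -/
def Generator.mark (x : D.Generator) (a : D.Point) : Bool := x.2 (D.circleOf x.1 a)

/-- The vector space underlying the Lee complex, with complex coefficients. -/
abbrev Chain : Type := D.Generator → ℂ

variable {D} in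
open Classical in
/-- The distinguished basis vector that belongs to a generator. -/
noncomputable def Generator.vec (x : D.Generator) : D.Chain := Pi.single x 1

/-! ### The Lee differential -/

/-- The coefficient of `v_z` in the product of `v_x` and `v_y`:
`v₊ v₊ = v₊`, `v₊ v₋ = v₋ v₊ = v₋`, `v₋ v₋ = v₊`, the last one being Lee's term. -/
def mulCoeff : Bool → Bool → Bool → ℂ
  | true, true, true => 1
  | true, false, false => 1
  | false, true, false => 1
  | false, false, true => 1
  | _, _, _ => 0

/-- The coefficient of `v_y ⊗ v_z` in the coproduct of `v_x`:
`v₊ ↦ v₊ ⊗ v₋ + v₋ ⊗ v₊` and `v₋ ↦ v₋ ⊗ v₋ + v₊ ⊗ v₊`, the last term being Lee's. -/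
def comulCoeff : Bool → Bool → Bool → ℂ
  | true, true, false => 1
  | true, false, true => 1
  | false, false, false => 1
  | false, true, true => 1
  | _, _, _ => 0

/-- There is an edge of the cube from `r` to `r'` that changes the smoothing of `c`. -/
def IsEdge (r r' : D.Vertex) (c : D.Crossing) : Prop :=
  r c = false ∧ r' c = true ∧ ∀ c', c' ≠ c → r' c' = r c'

open Classical in
/-- The sign of an edge that changes the smoothing of `c`. -/
noncomputable def edgeSign (r : D.Vertex) (c : D.Crossing) : ℂ :=
  (-1) ^ (Finset.univ.filter fun c' : D.Crossing => c'.1 < c.1 ∧ r c' = true).card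

/-- The markings of `x` and `y` agree on all circles that are disjoint from the crossing `c`.  In
either smoothing of `c` one of the two arcs at `c` ends at `inOuter c` and the other one
at `outInner c`. -/
def AgreeAway (x y : D.Generator) (c : D.Crossing) : Prop :=
  ∀ a, D.circleOf x.1 a ≠ D.circleOf x.1 (D.inOuter c) →
    D.circleOf x.1 a ≠ D.circleOf x.1 (D.outInner c) → y.mark a = x.mark a

open Classical in
/-- The matrix entry of the merge or split map at the crossing `c`: if the two arcs at `c` lie on
different circles, then these are merged, otherwise their circle is split. -/
noncomputable def saddleCoeff (x y : D.Generator) (c : D.Crossing) : ℂ :=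
  if D.circleOf x.1 (D.inOuter c) ≠ D.circleOf x.1 (D.outInner c) then
    mulCoeff (x.mark (D.inOuter c)) (x.mark (D.outInner c)) (y.mark (D.inOuter c))
  else
    comulCoeff (x.mark (D.inOuter c)) (y.mark (D.inOuter c)) (y.mark (D.outInner c))

open Classical in
/-- The coefficient of `y` in the Lee differential of `x`. -/
noncomputable def diffCoeff (x y : D.Generator) : ℂ :=
  ∑ c : D.Crossing, if D.IsEdge x.1 y.1 c ∧ D.AgreeAway x y c then
    D.edgeSign x.1 c * D.saddleCoeff x y c else 0

/-- The Lee differential. -/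
noncomputable def leeDiff : D.Chain →ₗ[ℂ] D.Chain :=
  Matrix.mulVecLin (Matrix.of fun y x => D.diffCoeff x y)

/-- The homology of the Lee complex: cycles modulo boundaries. -/
abbrev LeeHomology : Type :=
  LinearMap.ker D.leeDiff ⧸ (LinearMap.range D.leeDiff).submoduleOf (LinearMap.ker D.leeDiff)

/-- The homology class of a cycle. -/
noncomputable def homologyClass : LinearMap.ker D.leeDiff →ₗ[ℂ] D.LeeHomology :=
  Submodule.mkQ _

/-! ### Gradings -/

/-- A circle is nontrivial if it meets the radial arc `0`, which runs from `X` to `O`, in an odd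
number of points. -/
def IsNontrivial {r : D.Vertex} (C : D.Circle r) : Prop :=
  Odd (Nat.card {p : Fin (D.width 0) // D.circleOf r ⟨0, p⟩ = C})

/-- `v₊` has degree `1` and `v₋` has degree `-1`. -/
def markDegree (b : Bool) : ℤ := if b then 1 else -1

variable {D}

/-- The quantum grading, for the orientation `o`. -/
noncomputable def Orientation.jGrading (o : D.Orientation) (x : D.Generator) : ℤ :=
  (∑ C : D.Circle x.1, markDegree (x.2 C)) + (Nat.card {c : D.Crossing // x.1 c = true} : ℤ)
    + o.nPos - 2 * o.nNeg

variable (D) in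
open Classical in
/-- The annular grading: the algebraic intersection number of the radial arc `0` with the circles,
where those marked `v₊` run counterclockwise and those marked `v₋` run clockwise. -/
noncomputable def kGrading (x : D.Generator) : ℤ :=
  ∑ C : D.Circle x.1, if D.IsNontrivial C then markDegree (x.2 C) else 0

/-- The `j_t`-grading of a distinguished generator. -/
noncomputable def Orientation.jtGrading (o : D.Orientation) (t : ℝ) (x : D.Generator) : ℝ :=
  (o.jGrading x : ℝ) - t * (D.kGrading x : ℝ)

/-- The descending filtration of the Lee complex that is induced by the `j_t`-grading. -/
noncomputable def Orientation.filtration (o : D.Orientation) (t a : ℝ) : Submodule ℂ D.Chain :=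
  Submodule.span ℂ (Generator.vec '' {x | a ≤ o.jtGrading t x})

/-- The filtration grading of a nonzero chain `z`: the largest `a` such that `z` lies in step `a`
of the filtration. -/
noncomputable def Orientation.chainGrading (o : D.Orientation) (t : ℝ) (z : D.Chain) : ℝ :=
  sSup {a : ℝ | z ∈ o.filtration t a}

/-- The `j_t`-grading of a nonzero homology class: the largest grading of a cycle that
represents it. -/
noncomputable def Orientation.homologyGrading (o : D.Orientation) (t : ℝ) (η : D.LeeHomology) : ℝ :=
  sSup {g : ℝ | ∃ z : LinearMap.ker D.leeDiff, D.homologyClass z = η ∧ o.chainGrading t z = g}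

/-! ### The canonical cycles -/

/-- The oriented resolution. -/
def Orientation.vertex (o : D.Orientation) : D.Vertex := fun c => !o.isPositive c

/-- The number of intersections with the diagram of a radial ray that starts at the point `a` and
runs to `O`, not counting `a`, plus `1` if the strand at `a` runs counterclockwise around `X`.
Modulo `2` this is the number of circles of the oriented resolution that separate the circle of
`a` from `O`, plus `1` if that circle is oriented counterclockwise in the plane. -/
def Orientation.depth (o : D.Orientation) (a : D.Point) : ℕ :=
  a.2 + if o.dir a then 1 else 0

theorem resolved_of_not (r : D.Vertex) {s : Fin (D.len + 1)} (h : ¬ (D.piece s).IsCrossing) :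
    D.resolved r s = D.piece s := by
  rw [resolved, dif_neg h]
  revert h
  generalize D.piece s = e
  cases e <;> simp [AnnularPiece.smooth, AnnularPiece.IsCrossing]

theorem resolved_crossing (r : D.Vertex) (c : D.Crossing) :
    D.resolved r c.1 = if r c = (D.piece c.1).handed
      then AnnularPiece.turnback (D.piece c.1).index else AnnularPiece.straight := by
  have h := c.2.eq_cross
  unfold resolved
  rw [dif_pos c.2]
  conv_lhs => rw [h]
  rfl

/-- The oriented resolution turns back exactly at the crossings whose two strands run around `X` in
different directions. -/
theorem Orientation.resolved_vertex (o : D.Orientation) (c : D.Crossing) :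
    D.resolved o.vertex c.1 = if o.dir (D.inOuter c) = o.dir (D.inInner c)
      then AnnularPiece.straight else AnnularPiece.turnback (D.piece c.1).index := by
  rw [resolved_crossing]
  unfold vertex isPositive
  cases (D.piece c.1).handed <;> cases o.dir (D.inOuter c) <;> cases o.dir (D.inInner c) <;> simp

theorem Orientation.dir_outer (o : D.Orientation) (c : D.Crossing) (p' : Fin (D.width (c.1 + 1)))
    (h : (p' : ℕ) = (D.piece c.1).index) : o.dir ⟨c.1 + 1, p'⟩ = o.dir (D.inInner c) := by
  refine o.dir_through c.1 (D.inInner c).2 p' ?_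
  rw [c.2.eq_cross]
  exact Or.inr (Or.inl ⟨rfl, h⟩)

theorem Orientation.dir_inner (o : D.Orientation) (c : D.Crossing) (p' : Fin (D.width (c.1 + 1)))
    (h : (p' : ℕ) = (D.piece c.1).index + 1) : o.dir ⟨c.1 + 1, p'⟩ = o.dir (D.inOuter c) := by
  refine o.dir_through c.1 (D.inOuter c).2 p' ?_
  rw [c.2.eq_cross]
  exact Or.inl ⟨rfl, h⟩

theorem Orientation.dir_other (o : D.Orientation) (c : D.Crossing) (p : Fin (D.width c.1))
    (p' : Fin (D.width (c.1 + 1))) (h1 : (p : ℕ) ≠ (D.piece c.1).index)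
    (h2 : (p : ℕ) ≠ (D.piece c.1).index + 1) (h : (p' : ℕ) = p) :
    o.dir ⟨c.1 + 1, p'⟩ = o.dir ⟨c.1, p⟩ := by
  refine o.dir_through c.1 p p' ?_
  rw [c.2.eq_cross]
  exact Or.inr (Or.inr ⟨h1, h2, h⟩)

theorem Orientation.dir_in_outer (o : D.Orientation) (c : D.Crossing) (p : Fin (D.width c.1))
    (h : (p : ℕ) = (D.piece c.1).index) : o.dir ⟨c.1, p⟩ = o.dir (D.inOuter c) :=
  congrArg (fun x => o.dir ⟨c.1, x⟩) (Fin.ext h)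

theorem Orientation.dir_in_inner (o : D.Orientation) (c : D.Crossing) (p : Fin (D.width c.1))
    (h : (p : ℕ) = (D.piece c.1).index + 1) : o.dir ⟨c.1, p⟩ = o.dir (D.inInner c) :=
  congrArg (fun x => o.dir ⟨c.1, x⟩) (Fin.ext h)

theorem Orientation.depth_joined (o : D.Orientation) {a b : D.Point}
    (h : D.Joined o.vertex a b) : Even (o.depth a) = Even (o.depth b) := by
  unfold depth
  cases h with
  | through s p p' h =>
    have hpar : o.dir ⟨s + 1, p'⟩ = o.dir ⟨s, p⟩ ∧
        ((p' : ℕ) = p ∨ (p' : ℕ) = p + 2 ∨ (p : ℕ) = p' + 2) := by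
      by_cases hs : (D.piece s).IsCrossing
      · have hres := o.resolved_vertex ⟨s, hs⟩
        change D.resolved o.vertex s = _ at hres
        rw [hres] at h
        split_ifs at h with hd
        · have h' : (p' : ℕ) = p := h
          refine ⟨?_, Or.inl h'⟩
          by_cases h1 : (p : ℕ) = (D.piece s).index
          · rw [o.dir_outer ⟨s, hs⟩ p' (h'.trans h1), o.dir_in_outer ⟨s, hs⟩ p h1, hd]
          by_cases h2 : (p : ℕ) = (D.piece s).index + 1
          · rw [o.dir_inner ⟨s, hs⟩ p' (h'.trans h2), o.dir_in_inner ⟨s, hs⟩ p h2, hd]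
          exact o.dir_other ⟨s, hs⟩ p p' h1 h2 h'
        · exact ⟨o.dir_other ⟨s, hs⟩ p p' h.1 h.2.1 h.2.2, Or.inl h.2.2⟩
      · rw [D.resolved_of_not _ hs] at h
        exact ⟨o.dir_through s p p' h, h.near hs⟩
    rw [hpar.1]
    simp only [Nat.even_iff, eq_iff_iff]
    omega
  | turnsIn s p p' h =>
    have hdir : o.dir ⟨s, p'⟩ = !o.dir ⟨s, p⟩ := by
      by_cases hs : (D.piece s).IsCrossing
      · have hres := o.resolved_vertex ⟨s, hs⟩
        change D.resolved o.vertex s = _ at hres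
        rw [hres] at h
        split_ifs at h with hd
        · exact h.elim
        · rw [o.dir_in_outer ⟨s, hs⟩ p h.1, o.dir_in_inner ⟨s, hs⟩ p' h.2]
          exact Bool.eq_not.mpr fun e => hd e.symm
      · rw [D.resolved_of_not _ hs] at h
        exact o.dir_turnsIn s p p' h
    have := h.next
    rw [hdir]
    cases o.dir ⟨s, p⟩ <;> simp [this, Nat.even_add_one]
  | turnsOut s p p' h =>
    have hdir : o.dir ⟨s + 1, p'⟩ = !o.dir ⟨s + 1, p⟩ := by
      by_cases hs : (D.piece s).IsCrossing
      · have hres := o.resolved_vertex ⟨s, hs⟩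
        change D.resolved o.vertex s = _ at hres
        rw [hres] at h
        split_ifs at h with hd
        · exact h.elim
        · rw [o.dir_outer ⟨s, hs⟩ p h.1, o.dir_inner ⟨s, hs⟩ p' h.2]
          exact Bool.eq_not.mpr hd
      · rw [D.resolved_of_not _ hs] at h
        exact o.dir_turnsOut s p p' h
    have := h.next
    rw [hdir]
    cases o.dir ⟨s + 1, p⟩ <;> simp [this, Nat.even_add_one]

/-- Whether a circle of the oriented resolution is labelled by `a = v₋ + v₊` (`true`) or by
`b = v₋ - v₊` (`false`). -/
def Orientation.isA (o : D.Orientation) : D.Circle o.vertex → Bool :=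
  Quot.lift (fun a => decide (Even (o.depth a))) fun _ _ h => by
    simp only [o.depth_joined h]

/-- The coefficient of `v₊` or `v₋` (second argument) in `a` or `b` (first argument). -/
def labelCoeff : Bool → Bool → ℂ
  | false, true => -1
  | _, _ => 1

/-- The canonical chain of an orientation: every circle of the oriented resolution is labelled by
`a` or `b`. -/
noncomputable def Orientation.canonicalChain (o : D.Orientation) : D.Chain :=
  ∑ m : D.Circle o.vertex → Bool,
    (∏ C, labelCoeff (o.isA C) (m C)) • Generator.vec (⟨o.vertex, m⟩ : D.Generator)

theorem leeDiff_vec (x y : D.Generator) : D.leeDiff x.vec y = D.diffCoeff x y := by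
  classical
  simp [leeDiff, Generator.vec]

theorem Orientation.isA_inOuter (o : D.Orientation) (c : D.Crossing) :
    o.isA (D.circleOf o.vertex (D.inOuter c)) = !o.isA (D.circleOf o.vertex (D.outInner c)) := by
  change decide (Even (o.depth (D.inOuter c))) = !decide (Even (o.depth (D.outInner c)))
  have h := o.dir_inner c (D.outInner c).2 rfl
  change o.dir (D.outInner c) = _ at h
  unfold depth
  rw [h]
  change decide (Even ((D.piece c.1).index + _)) = !decide (Even ((D.piece c.1).index + 1 + _))
  cases o.dir (D.inOuter c) <;>
    simp [Nat.even_add_one, -Nat.not_even_iff_odd]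

theorem Orientation.leeDiff_canonicalChain (o : D.Orientation) :
    D.leeDiff o.canonicalChain = 0 := by
  classical
  funext y
  simp only [canonicalChain, map_sum, map_smul, Finset.sum_apply, Pi.smul_apply, leeDiff_vec,
    diffCoeff, smul_eq_mul, Finset.mul_sum, Pi.zero_apply]
  rw [Finset.sum_comm]
  refine Finset.sum_eq_zero fun c _ => ?_
  have hA := o.isA_inOuter c
  set P := D.circleOf o.vertex (D.inOuter c) with hP
  set Q := D.circleOf o.vertex (D.outInner c) with hQ
  have hPQ : P ≠ Q := by
    intro h
    rw [h] at hA
    simp at hA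
  -- flip the markings of the two circles at the crossing
  let flip : (D.Circle o.vertex → Bool) → (D.Circle o.vertex → Bool) :=
    fun m C => if C = P ∨ C = Q then !m C else m C
  have hflip : ∀ m, (∏ C, labelCoeff (o.isA C) (flip m C))
      = -∏ C, labelCoeff (o.isA C) (m C) := by
    intro m
    rw [← Finset.mul_prod_erase _ _ (Finset.mem_univ P),
      ← Finset.mul_prod_erase _ _ (Finset.mem_univ P),
      ← Finset.mul_prod_erase _ _ (Finset.mem_erase.mpr ⟨hPQ.symm, Finset.mem_univ Q⟩),
      ← Finset.mul_prod_erase _ _ (Finset.mem_erase.mpr ⟨hPQ.symm, Finset.mem_univ Q⟩)]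
    have hrest : ∏ C ∈ (Finset.univ.erase P).erase Q, labelCoeff (o.isA C) (flip m C)
        = ∏ C ∈ (Finset.univ.erase P).erase Q, labelCoeff (o.isA C) (m C) := by
      refine Finset.prod_congr rfl fun C hC => ?_
      simp only [Finset.mem_erase] at hC
      simp [flip, hC.1, hC.2.1]
    rw [hrest, ← mul_assoc, ← mul_assoc, ← neg_mul]
    congr 1
    simp only [flip, hA, true_or, or_true, if_true]
    cases o.isA Q <;> cases m P <;> cases m Q <;> simp [labelCoeff]
  have hinv : Function.Involutive flip := by
    intro m
    funext C
    simp only [flip]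
    split_ifs <;> simp
  have hterm : ∀ m, (if D.IsEdge o.vertex y.1 c ∧ D.AgreeAway ⟨o.vertex, flip m⟩ y c then
      D.edgeSign o.vertex c * D.saddleCoeff ⟨o.vertex, flip m⟩ y c else 0)
      = if D.IsEdge o.vertex y.1 c ∧ D.AgreeAway ⟨o.vertex, m⟩ y c then
      D.edgeSign o.vertex c * D.saddleCoeff ⟨o.vertex, m⟩ y c else 0 := by
    intro m
    have h1 : D.AgreeAway ⟨o.vertex, flip m⟩ y c ↔ D.AgreeAway ⟨o.vertex, m⟩ y c := by
      refine forall_congr' fun a => forall_congr' fun h1 => forall_congr' fun h2 => ?_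
      have : Generator.mark ⟨o.vertex, flip m⟩ a = Generator.mark ⟨o.vertex, m⟩ a := by
        change flip m (D.circleOf o.vertex a) = m (D.circleOf o.vertex a)
        exact if_neg (not_or.mpr ⟨h1, h2⟩)
      rw [this]
    have h2 : D.saddleCoeff ⟨o.vertex, flip m⟩ y c = D.saddleCoeff ⟨o.vertex, m⟩ y c := by
      unfold saddleCoeff
      rw [if_pos hPQ, if_pos hPQ]
      change mulCoeff (flip m P) (flip m Q) _ = mulCoeff (m P) (m Q) _
      simp only [flip, true_or, or_true, if_true]
      cases m P <;> cases m Q <;> cases y.mark (D.inOuter c) <;> rfl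
    rw [h1, h2]
  refine self_eq_neg.mp ((Equiv.sum_comp hinv.toPerm _).symm.trans ?_)
  rw [← Finset.sum_neg_distrib]
  refine Finset.sum_congr rfl fun m _ => ?_
  rw [← neg_mul, ← hflip m, ← hterm m]
  rfl

/-- The canonical homology class of an orientation. -/
noncomputable def Orientation.canonicalClass (o : D.Orientation) : D.LeeHomology :=
  D.homologyClass ⟨o.canonicalChain, LinearMap.mem_ker.mpr o.leeDiff_canonicalChain⟩

/-- The annular Rasmussen invariant `d_t`. -/
noncomputable def Orientation.annularRasmussen (o : D.Orientation) (t : ℝ) : ℝ :=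
  o.homologyGrading t o.canonicalClass

end AnnularDiagram

/-! Every term of the Lee differential changes the quantum grading `j` by `0` or `4`. Hence the
diagonal map `twist`, which multiplies a generator by `i ^ j` up to a constant, commutes with the
differential (`leeDiff_twist`). Being diagonal in the distinguished basis, it preserves every
filtration that is spanned by generators, in particular that of `j_t`. It sends `v₊` to `i v₊` and
`v₋` to `-i v₋`, so it exchanges the labels `a` and `b` up to the scalar `-i`, and therefore carries
the canonical cycle of `o` to a nonzero multiple of that of the opposite orientation. The two
classes thus have the same grading `d_t`. Each filtration step is a subspace, so no nonzero
combination of the classes has a smaller grading, and `[s_o]` itself attains the minimum.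

Nonvanishing comes from the bilinear pairing with the canonical chain. The two circles at any
crossing of the oriented resolution are distinct with opposite labels, so an edge arriving there is
a split. The image of a split is symmetric under flipping both marks, while the canonical chain is
antisymmetric, so boundaries pair to zero. The canonical chain pairs nontrivially with itself.

Both arguments need every edge of the cube to be a merge or a split (`IsEdge.circleOf_eq_iff`).
Orienting strands by the parity of their number makes the circles the cycles of a permutation of the
points. Changing a smoothing multiplies it by a transposition, which joins or separates the two
transposed points. -/

/-! ### Crossingless sectors as pairings of strand ends -/

namespace AnnularPiece

/-- The sector read clockwise. -/
def mirror : AnnularPiece → AnnularPiece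
  | birth q => death q
  | death q => birth q
  | e => e

/-- Where an incoming strand of a crossingless sector ends: `true` means on the outgoing radial arc,
`false` means on the incoming one. -/
def exit : AnnularPiece → ℕ → Bool × ℕ
  | turnback q, p => if p = q then (false, q + 1) else if p = q + 1 then (false, q) else (true, p)
  | birth q, p => if p < q then (true, p) else (true, p + 2)
  | death q, p => if p < q then (true, p) else if p = q then (false, q + 1)
      else if p = q + 1 then (false, q) else (true, p - 2)
  | _, p => (true, p)

theorem mirror_mirror (e : AnnularPiece) : e.mirror.mirror = e := by
  cases e <;> rfl

theorem Fits.mirror {e : AnnularPiece} {m n : ℕ} (h : e.Fits m n) : e.mirror.Fits n m := by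
  cases e <;> simp only [Fits, AnnularPiece.mirror] at h ⊢ <;> omega

theorem exit_lt_of_true {e : AnnularPiece} {m n p p' : ℕ} (h : e.Fits m n) (hp : p < m)
    (hx : e.exit p = (true, p')) : p' < n := by
  cases e <;> simp only [Fits, exit] at h hx <;> (try split_ifs at hx) <;>
    simp only [Prod.mk.injEq, Bool.false_eq_true, false_and, true_and] at hx <;> omega

theorem exit_lt_of_false {e : AnnularPiece} {m n p p' : ℕ} (h : e.Fits m n) (_hp : p < m)
    (hx : e.exit p = (false, p')) : p' < m := by
  cases e <;> simp only [Fits, exit] at h hx <;> (try split_ifs at hx) <;>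
    simp only [Prod.mk.injEq, Bool.true_eq_false, false_and, true_and] at hx <;> omega

theorem exit_mirror {e : AnnularPiece} {p p' : ℕ} (hx : e.exit p = (true, p')) :
    e.mirror.exit p' = (true, p) := by
  cases e <;> simp only [exit, mirror] at hx ⊢ <;> (try split_ifs at hx) <;>
    simp only [Prod.mk.injEq, Bool.false_eq_true, false_and, true_and] at hx <;> grind

theorem exit_comm {e : AnnularPiece} {p p' : ℕ} (hx : e.exit p = (false, p')) :
    e.exit p' = (false, p) := by
  cases e <;> simp only [exit] at hx ⊢ <;> (try split_ifs at hx) <;>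
    simp only [Prod.mk.injEq, Bool.true_eq_false, false_and, true_and] at hx <;> grind

/-- Births and deaths shift strand numbers by two and turns join neighbours. This is what makes the
orientation by parity consistent along circles. -/
theorem exit_parity {e : AnnularPiece} {b : Bool} {p p' : ℕ} (hx : e.exit p = (b, p')) :
    p' % 2 = p % 2 ↔ b = true := by
  cases e <;> simp only [exit] at hx <;> (try split_ifs at hx) <;>
    simp only [Prod.mk.injEq] at hx <;> obtain ⟨rfl, rfl⟩ := hx <;> simp <;> omega

theorem through_iff {e : AnnularPiece} (he : ¬ e.IsCrossing) {p p' : ℕ} :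
    e.Through p p' ↔ e.exit p = (true, p') := by
  cases e <;> simp only [Through, exit, IsCrossing, not_true_eq_false] at he ⊢ <;>
    (try split_ifs) <;> simp <;> omega

theorem turnsIn_or_iff {e : AnnularPiece} {p p' : ℕ} :
    (e.TurnsIn p p' ∨ e.TurnsIn p' p) ↔ e.exit p = (false, p') := by
  cases e <;> simp only [TurnsIn, exit] <;> (try split_ifs) <;> simp <;> omega

theorem turnsOut_or_iff {e : AnnularPiece} {p p' : ℕ} :
    (e.TurnsOut p p' ∨ e.TurnsOut p' p) ↔ e.mirror.exit p = (false, p') := by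
  cases e <;> simp only [TurnsOut, exit, mirror] <;> (try split_ifs) <;> simp <;> omega

end AnnularPiece

/-! ### Circles of a resolution as cycles of a permutation -/

namespace AnnularDiagram

variable (D : AnnularDiagram)

theorem not_isCrossing_resolved (r : D.Vertex) (s : Fin (D.len + 1)) :
    ¬ (D.resolved r s).IsCrossing := by
  by_cases h : (D.piece s).IsCrossing
  · rw [show D.resolved r s = _ from D.resolved_crossing r ⟨s, h⟩]
    split_ifs <;> exact id
  · rwa [D.resolved_of_not r h]

theorem resolved_fits (r : D.Vertex) (s : Fin (D.len + 1)) :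
    (D.resolved r s).Fits (D.width s) (D.width (s + 1)) := by
  by_cases h : (D.piece s).IsCrossing
  · have := h.fits (D.fits s)
    rw [show D.resolved r s = _ from D.resolved_crossing r ⟨s, h⟩]
    split_ifs
    · exact this
    · exact this.2
  · rw [D.resolved_of_not r h]
    exact D.fits s

theorem resolved_fits_pred (r : D.Vertex) (s : Fin (D.len + 1)) :
    (D.resolved r (s - 1)).mirror.Fits (D.width s) (D.width (s - 1)) := by
  have := (D.resolved_fits r (s - 1)).mirror
  rwa [sub_add_cancel] at this

variable {D}

theorem Point.ext {a b : D.Point} (h1 : a.1 = b.1) (h2 : (a.2 : ℕ) = b.2) : a = b := by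
  obtain ⟨s, p⟩ := a
  obtain ⟨s', p'⟩ := b
  obtain rfl : s = s' := h1
  exact congrArg _ (Fin.ext h2)

variable (D)

/-- Orient all circles of the resolution at `r` so that the strands whose number has the parity of
`e` run counterclockwise.  This is the point that follows `a`. -/
noncomputable def step (r : D.Vertex) (e : ℕ) (a : D.Point) : D.Point :=
  if Even (a.2 + e) then
    match h : (D.resolved r a.1).exit a.2 with
    | (true, p) => ⟨a.1 + 1, p, AnnularPiece.exit_lt_of_true (D.resolved_fits r a.1) a.2.2 h⟩
    | (false, p) => ⟨a.1, p, AnnularPiece.exit_lt_of_false (D.resolved_fits r a.1) a.2.2 h⟩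
  else
    match h : (D.resolved r (a.1 - 1)).mirror.exit a.2 with
    | (true, p) => ⟨a.1 - 1, p, AnnularPiece.exit_lt_of_true (D.resolved_fits_pred r a.1) a.2.2 h⟩
    | (false, p) => ⟨a.1, p, AnnularPiece.exit_lt_of_false (D.resolved_fits_pred r a.1) a.2.2 h⟩

/-- The graph of `step`. -/
inductive Follows (r : D.Vertex) (e : ℕ) (a b : D.Point) : Prop
  | across : Even (a.2 + e) → (D.resolved r a.1).exit a.2 = (true, (b.2 : ℕ)) → b.1 = a.1 + 1 →
      Follows r e a b
  | turn : Even (a.2 + e) → (D.resolved r a.1).exit a.2 = (false, (b.2 : ℕ)) → b.1 = a.1 →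
      Follows r e a b
  | back : ¬ Even (a.2 + e) → (D.resolved r b.1).mirror.exit a.2 = (true, (b.2 : ℕ)) →
      a.1 = b.1 + 1 → Follows r e a b
  | turnBack : ¬ Even (a.2 + e) → (D.resolved r (a.1 - 1)).mirror.exit a.2 = (false, (b.2 : ℕ)) →
      b.1 = a.1 → Follows r e a b

variable {D} {r : D.Vertex} {e : ℕ}

theorem follows_step (a : D.Point) : D.Follows r e a (D.step r e a) := by
  unfold step
  split_ifs with h
  · split
    · exact .across h ‹_› rfl
    · exact .turn h ‹_› rfl
  · split
    · exact .back h ‹_› (sub_add_cancel _ _).symm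
    · exact .turnBack h ‹_› rfl

theorem Follows.unique {a b b' : D.Point} (h : D.Follows r e a b) (h' : D.Follows r e a b') :
    b = b' := by
  have key : ∀ {s s' : Fin (D.len + 1)}, a.1 = s + 1 → a.1 = s' + 1 → s = s' :=
    fun h h' => add_right_cancel (h.symm.trans h')
  have key' : ∀ {s : Fin (D.len + 1)}, a.1 = s + 1 → a.1 - 1 = s :=
    fun h => by rw [h, add_sub_cancel_right]
  cases h with
  | across he hx hs =>
    cases h' with
    | across he' hx' hs' => exact Point.ext (hs.trans hs'.symm) (by simp_all)
    | turn he' hx' hs' => simp_all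
    | back he' => exact absurd he he'
    | turnBack he' => exact absurd he he'
  | turn he hx hs =>
    cases h' with
    | across he' hx' hs' => simp_all
    | turn he' hx' hs' => exact Point.ext (hs.trans hs'.symm) (by simp_all)
    | back he' => exact absurd he he'
    | turnBack he' => exact absurd he he'
  | back he hx hs =>
    cases h' with
    | across he' => exact absurd he' he
    | turn he' => exact absurd he' he
    | back he' hx' hs' =>
      have := key hs hs'
      have hb : (D.resolved r b.1).mirror.exit a.2 = (D.resolved r b'.1).mirror.exit a.2 := by
        rw [this]
      rw [hx, hx'] at hb
      exact Point.ext this (by simpa using hb)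
    | turnBack he' hx' hs' =>
      rw [key' hs, hx] at hx'
      simp at hx'
  | turnBack he hx hs =>
    cases h' with
    | across he' => exact absurd he' he
    | turn he' => exact absurd he' he
    | back he' hx' hs' =>
      rw [key' hs', hx'] at hx
      simp at hx
    | turnBack he' hx' hs' => exact Point.ext (hs.trans hs'.symm) (by simp_all)

theorem follows_iff {a b : D.Point} : D.Follows r e a b ↔ D.step r e a = b :=
  ⟨fun h => (follows_step a).unique h, fun h => h ▸ follows_step a⟩

/-- Raising `e` by one reverses all strands. A through strand is then read in the mirrored sector,
and a turn is run from its other end, whose number has the other parity. -/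
theorem Follows.symm {a b : D.Point} (h : D.Follows r e a b) : D.Follows r (e + 1) b a := by
  cases h with
  | across he hx hs =>
    have := (AnnularPiece.exit_parity hx).2 rfl
    exact .back (by grind) (AnnularPiece.exit_mirror hx) hs
  | turn he hx hs =>
    have := (AnnularPiece.exit_parity hx).not.2 (by simp)
    exact .turn (by grind) ((congrArg (fun s => (D.resolved r s).exit b.2) hs).trans
      (AnnularPiece.exit_comm hx)) hs.symm
  | back he hx hs =>
    have := (AnnularPiece.exit_parity hx).2 rfl
    have hx' := AnnularPiece.exit_mirror hx
    rw [AnnularPiece.mirror_mirror] at hx'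
    exact .across (by grind) hx' hs
  | turnBack he hx hs =>
    have := (AnnularPiece.exit_parity hx).not.2 (by simp)
    exact .turnBack (by grind) ((congrArg (fun s => (D.resolved r (s - 1)).mirror.exit b.2) hs).trans
      (AnnularPiece.exit_comm hx)) hs.symm

/-- Only the parity of `e` matters, so reversing twice is harmless and `step` at `e + 1` is a
two-sided inverse of `step` at `e`. -/
theorem follows_add_two {a b : D.Point} : D.Follows r (e + 2) a b ↔ D.Follows r e a b := by
  have h : Even ((a.2 : ℕ) + (e + 2)) ↔ Even ((a.2 : ℕ) + e) := by grind
  constructor <;> rintro (⟨h1, h2, h3⟩ | ⟨h1, h2, h3⟩ | ⟨h1, h2, h3⟩ | ⟨h1, h2, h3⟩)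
  · exact .across (h.1 h1) h2 h3
  · exact .turn (h.1 h1) h2 h3
  · exact .back (h.not.1 h1) h2 h3
  · exact .turnBack (h.not.1 h1) h2 h3
  · exact .across (h.2 h1) h2 h3
  · exact .turn (h.2 h1) h2 h3
  · exact .back (h.not.2 h1) h2 h3
  · exact .turnBack (h.not.2 h1) h2 h3

variable (D r e) in
/-- The permutation of the points whose cycles are the circles of the resolution at `r`. -/
noncomputable def stepPerm : Equiv.Perm D.Point where
  toFun := D.step r e
  invFun := D.step r (e + 1)
  left_inv a := follows_iff.1 (follows_step a).symm
  right_inv a := follows_iff.1 (follows_add_two.1 (follows_step a).symm)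

theorem Follows.circleOf_eq {a b : D.Point} (h : D.Follows r e a b) :
    D.circleOf r b = D.circleOf r a := by
  have hn := D.not_isCrossing_resolved r
  obtain ⟨s, p⟩ := a
  obtain ⟨s', p'⟩ := b
  cases h with
  | across he hx hs =>
    obtain rfl : s' = s + 1 := hs
    exact (Quot.sound (.through s p p' ((AnnularPiece.through_iff (hn s)).2 hx))).symm
  | turn he hx hs =>
    obtain rfl : s' = s := hs
    rcases AnnularPiece.turnsIn_or_iff.2 hx with h | h
    · exact (Quot.sound (.turnsIn _ p p' h)).symm
    · exact Quot.sound (.turnsIn _ p' p h)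
  | back he hx hs =>
    obtain rfl : s = s' + 1 := hs
    have hx' := AnnularPiece.exit_mirror hx
    rw [AnnularPiece.mirror_mirror] at hx'
    exact Quot.sound (.through s' p' p ((AnnularPiece.through_iff (hn s')).2 hx'))
  | turnBack he hx hs =>
    obtain rfl : s' = s := hs
    -- `Joined.turnsOut` speaks of the radial arc at the end of a sector, so the arc has to be
    -- written as a successor.
    obtain ⟨s, rfl⟩ : ∃ s₁, s' = s₁ + 1 := ⟨s' - 1, (sub_add_cancel _ _).symm⟩
    simp only [add_sub_cancel_right] at hx
    rcases AnnularPiece.turnsOut_or_iff.2 hx with h | h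
    · exact (Quot.sound (.turnsOut s p p' h)).symm
    · exact Quot.sound (.turnsOut s p' p h)

theorem circleOf_stepPerm (a : D.Point) : D.circleOf r (D.stepPerm r e a) = D.circleOf r a :=
  (follows_step a).circleOf_eq

theorem Joined.follows {a b : D.Point} (h : D.Joined r a b) :
    D.Follows r e a b ∨ D.Follows r e b a := by
  have hn := D.not_isCrossing_resolved r
  cases h with
  | through s p p' h =>
    have hx := (AnnularPiece.through_iff (hn s)).1 h
    have := (AnnularPiece.exit_parity hx).2 rfl
    by_cases he : Even ((p : ℕ) + e)
    · exact .inl (.across he hx rfl)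
    · exact .inr (.back (by grind) (AnnularPiece.exit_mirror hx) rfl)
  | turnsIn s p p' h =>
    have hx := AnnularPiece.turnsIn_or_iff.1 (.inl h)
    have := h.next
    by_cases he : Even ((p : ℕ) + e)
    · exact .inl (.turn he hx rfl)
    · exact .inr (.turn (by grind) (AnnularPiece.exit_comm hx) rfl)
  | turnsOut s p p' h =>
    have hx := AnnularPiece.turnsOut_or_iff.1 (.inl h)
    replace hx : (D.resolved r (s + 1 - 1)).mirror.exit p = (false, (p' : ℕ)) := by
      rwa [add_sub_cancel_right]
    have := h.next
    by_cases he : Even ((p : ℕ) + e)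
    · exact .inr (.turnBack (by grind) (AnnularPiece.exit_comm hx) rfl)
    · exact .inl (.turnBack he hx rfl)

/-- Each arc of the resolution is a single step in one direction or the other, and each step runs
along an arc. Either parity of `e` serves, so it can be chosen to suit a crossing. -/
theorem circleOf_eq_iff {a b : D.Point} :
    D.circleOf r a = D.circleOf r b ↔ (D.stepPerm r e).SameCycle a b := by
  constructor
  · intro h
    replace h : Relation.EqvGen (D.Joined r) a b := Quot.eqvGen_exact h
    induction h with
    | rel a b h =>
      rcases h.follows (e := e) with h | h
      · exact ⟨1, (zpow_one (D.stepPerm r e)).symm ▸ follows_iff.1 h⟩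
      · exact .symm ⟨1, (zpow_one (D.stepPerm r e)).symm ▸ follows_iff.1 h⟩
    | refl => exact .refl _ _
    | symm _ _ _ ih => exact ih.symm
    | trans _ _ _ _ _ ih ih' => exact ih.trans ih'
  · intro h
    obtain ⟨n, -, rfl⟩ := h.exists_pow_eq' 
    clear h
    induction n with
    | zero => rfl
    | succ n ih => rw [pow_succ', Equiv.Perm.mul_apply, circleOf_stepPerm, ih]

end AnnularDiagram

/-! ### Multiplying a permutation by a transposition -/

namespace Equiv.Perm

variable {α : Type*} [DecidableEq α] [Finite α] {f : Perm α} {x y : α}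

/-- If `n` is the first positive time at which `f` takes `x` to `y`, the new orbit of `y` stays
among `f x, ..., f ^ n x = y` and so misses `x`. -/
theorem not_sameCycle_mul_swap (hxy : x ≠ y) (h : f.SameCycle x y) :
    ¬ (f * swap x y).SameCycle x y := by
  classical
  have hex : ∃ n, 0 < n ∧ (f ^ n) x = y := by
    obtain ⟨n, hn, -, h⟩ := h.exists_pow_eq''
    exact ⟨n, hn, h⟩
  set n := Nat.find hex
  obtain ⟨hn, hny⟩ : 0 < n ∧ (f ^ n) x = y := Nat.find_spec hex
  have hmin : ∀ i, 0 < i → i < n → (f ^ i) x ≠ y := fun i h1 h2 h3 => Nat.find_min hex h2 ⟨h1, h3⟩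
  have hx : ∀ i, 0 < i → i ≤ n → (f ^ i) x ≠ x := by
    intro i h1 h2 h3
    have h4 : i ≠ n := by
      rintro rfl
      exact hxy (h3.symm.trans hny)
    -- An earlier return to `x` at time `i` would already bring `x` to `y` at time `n - i`.
    refine hmin (n - i) (by omega) (by omega) ?_
    rw [← hny]
    conv_lhs => rw [← h3]
    rw [← mul_apply, ← pow_add]
    congr 2
    omega
  have key : ∀ k : ℕ, ∃ i, 0 < i ∧ i ≤ n ∧ ((f * swap x y) ^ k) y = (f ^ i) x := by
    intro k
    induction k with
    | zero => exact ⟨n, hn, le_rfl, hny.symm⟩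
    | succ k ih =>
      obtain ⟨i, h1, h2, h3⟩ := ih
      rw [pow_succ', mul_apply, h3]
      rcases h2.eq_or_lt with h2 | h2
      -- At `y` the transposition restarts the walk from `x`, and the following `f` makes the
      -- exponent `1`, never `0`.
      · exact ⟨1, one_pos, hn, by rw [h2, hny]; simp⟩
      · refine ⟨i + 1, by omega, h2, ?_⟩
        rw [mul_apply, swap_apply_of_ne_of_ne (hx i h1 h2.le) (hmin i h1 h2), pow_succ', mul_apply]
  intro hg
  obtain ⟨k, -, hk⟩ := hg.symm.exists_pow_eq'
  obtain ⟨i, h1, h2, h3⟩ := key k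
  exact hx i h1 h2 (h3.symm.trans hk)

/-- From `y` the new permutation jumps to `f x` and then follows the old cycle of `x`, which does
not contain `y`, until it closes up at `x`. -/
theorem sameCycle_mul_swap (h : ¬ f.SameCycle x y) : (f * swap x y).SameCycle x y := by
  classical
  have hex : ∃ n, 0 < n ∧ (f ^ n) x = x := by
    obtain ⟨n, hn, -, h⟩ := (SameCycle.refl f x).exists_pow_eq''
    exact ⟨n, hn, h⟩
  set n := Nat.find hex
  obtain ⟨hn, hnx⟩ : 0 < n ∧ (f ^ n) x = x := Nat.find_spec hex
  have hmin : ∀ i, 0 < i → i < n → (f ^ i) x ≠ x := fun i h1 h2 h3 => Nat.find_min hex h2 ⟨h1, h3⟩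
  have key : ∀ k < n, ((f * swap x y) ^ (k + 1)) y = (f ^ (k + 1)) x := by
    intro k hk
    induction k with
    | zero => simp
    | succ k ih =>
      rw [pow_succ', mul_apply, ih (by omega), mul_apply, swap_apply_of_ne_of_ne
        (hmin _ (by omega) hk) fun h' => h ⟨(k + 1 : ℕ), by rw [zpow_natCast, h']⟩,
        pow_succ' f (k + 1), mul_apply]
  refine SameCycle.symm ⟨n, ?_⟩
  have := key (n - 1) (by omega)
  rwa [Nat.sub_add_cancel hn, hnx] at this

theorem sameCycle_mul_swap_iff (hxy : x ≠ y) :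
    (f * swap x y).SameCycle x y ↔ ¬ f.SameCycle x y :=
  ⟨fun h h' => not_sameCycle_mul_swap hxy h' h, sameCycle_mul_swap⟩

end Equiv.Perm

/-! ### How the circles change along an edge of the cube -/

namespace AnnularDiagram

variable {D : AnnularDiagram} {r r' : D.Vertex} {c : D.Crossing}

theorem inOuter_ne_outInner (c : D.Crossing) : D.inOuter c ≠ D.outInner c := by
  intro h
  have : ∀ {a b : D.Point}, a = b → (a.2 : ℕ) = b.2 := by
    rintro a _ rfl
    rfl
  have := this h
  simp [inOuter, outInner] at this

theorem resolved_congr {s : Fin (D.len + 1)} (h : ∀ c : D.Crossing, c.1 = s → r' c = r c) :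
    D.resolved r' s = D.resolved r s := by
  unfold resolved
  split_ifs with hs
  · rw [h ⟨s, hs⟩ rfl]
  · rfl

open Classical in
-- With `e` equal to the index of the crossing, `inOuter` and `outInner` are the two points at which
-- the parity orientation enters the crossing. Passing from the straight to the turnback smoothing
-- exchanges their successors and leaves all others alone.
theorem stepPerm_eq_mul_swap_of_straight
    (hne : ∀ s, s ≠ c.1 → D.resolved r' s = D.resolved r s)
    (h : D.resolved r c.1 = .straight)
    (h' : D.resolved r' c.1 = .turnback (D.piece c.1).index) :
    D.stepPerm r' (D.piece c.1).index
      = D.stepPerm r (D.piece c.1).index * Equiv.swap (D.inOuter c) (D.outInner c) := by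
  set q := (D.piece c.1).index with hq
  have hqc := c.2.fits (D.fits c.1)
  have hout : q < D.width (c.1 + 1) := by omega
  have hin : q + 1 < D.width c.1 := by omega
  -- the strands that enter the crossing
  have hA : ∀ {a : D.Point}, a.1 = c.1 → (a.2 : ℕ) = q → a = D.inOuter c := fun h1 h2 =>
    Point.ext h1 h2
  have hB : ∀ {a : D.Point}, a.1 = c.1 + 1 → (a.2 : ℕ) = q + 1 → a = D.outInner c := fun h1 h2 =>
    Point.ext h1 h2
  ext1 a
  change D.step r' q a = D.step r q (Equiv.swap (D.inOuter c) (D.outInner c) a)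
  rw [← follows_iff]
  by_cases ha : a = D.inOuter c
  · subst ha
    rw [Equiv.swap_apply_left]
    have : D.Follows r q (D.outInner c) ⟨c.1, q + 1, hin⟩ := by
      refine .back ?_ ?_ rfl
      · change ¬ Even (q + 1 + q)
        grind
      · change (D.resolved r c.1).mirror.exit (q + 1) = (true, q + 1)
        rw [h]
        rfl
    rw [follows_iff.1 this]
    refine .turn ?_ ?_ rfl
    · exact ⟨q, rfl⟩
    · change (D.resolved r' c.1).exit q = (false, q + 1)
      simp [h', AnnularPiece.exit]
  by_cases hb : a = D.outInner c
  · subst hb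
    rw [Equiv.swap_apply_right]
    have : D.Follows r q (D.inOuter c) ⟨c.1 + 1, q, hout⟩ := by
      refine .across ?_ ?_ rfl
      · exact ⟨q, rfl⟩
      · change (D.resolved r c.1).exit q = (true, q)
        rw [h]
        rfl
    rw [follows_iff.1 this]
    refine .turnBack ?_ ?_ rfl
    · change ¬ Even (q + 1 + q)
      grind
    · change (D.resolved r' (c.1 + 1 - 1)).mirror.exit (q + 1) = (false, q)
      simp [h', AnnularPiece.exit, AnnularPiece.mirror]
  rw [Equiv.swap_apply_of_ne_of_ne ha hb]
  have hf := follows_step (r := r) (e := q) a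
  generalize D.step r q a = b at hf ⊢
  have hturn : ∀ p, p ≠ q → p ≠ q + 1 → (AnnularPiece.turnback q).exit p = (true, p) :=
    fun p h1 h2 => by simp [AnnularPiece.exit, h1, h2]
  have hr : ∀ s, s = c.1 → D.resolved r s = .straight := by
    rintro _ rfl
    exact h
  have hr' : ∀ s, s = c.1 → D.resolved r' s = .turnback q := by
    rintro _ rfl
    exact h'
  cases hf with
  | across he hx hs =>
    refine .across he ?_ hs
    by_cases hac : a.1 = c.1
    · rw [hr _ hac] at hx
      rw [hr' _ hac, hturn, ← hx]
      · rfl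
      · exact fun h => ha (hA hac h)
      · grind
    · rwa [hne _ hac]
  | turn he hx hs =>
    refine .turn he ?_ hs
    rwa [hne]
    intro hac
    rw [hr _ hac] at hx
    simp [AnnularPiece.exit] at hx
  | back he hx hs =>
    refine .back he ?_ hs
    by_cases hac : b.1 = c.1
    · have e1 : (D.resolved r b.1).mirror.exit a.2 = (true, (a.2 : ℕ)) := by
        rw [hr _ hac]
        rfl
      have e2 : (D.resolved r' b.1).mirror.exit a.2 = (true, (a.2 : ℕ)) := by
        rw [hr' _ hac]
        refine hturn _ ?_ ?_
        · intro h
          exact he ⟨q, by rw [h]⟩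
        · exact fun h => hb (hB (by rw [hs, hac]) h)
      rw [e2, ← e1, hx]
    · rwa [hne _ hac]
  | turnBack he hx hs =>
    refine .turnBack he ?_ hs
    rwa [hne]
    intro hac
    rw [hr _ hac] at hx
    simp [AnnularPiece.exit, AnnularPiece.mirror] at hx

open Classical in
/-- Changing the smoothing of a crossing multiplies the permutation by a transposition. -/
theorem IsEdge.stepPerm_eq (h : D.IsEdge r r' c) :
    D.stepPerm r' (D.piece c.1).index
      = D.stepPerm r (D.piece c.1).index * Equiv.swap (D.inOuter c) (D.outInner c) := by
  have hne : ∀ s, s ≠ c.1 → D.resolved r' s = D.resolved r s := fun s hs =>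
    resolved_congr fun c' hc' => h.2.2 c' (by rintro rfl; exact hs hc'.symm)
  have h1 := D.resolved_crossing r c
  have h2 := D.resolved_crossing r' c
  rw [h.1] at h1
  rw [h.2.1] at h2
  cases hh : (D.piece c.1).handed
  -- Here the `0`-smoothing is the turnback, so `r` and `r'` exchange roles, and the transposition
  -- is its own inverse.
  · simp only [hh, if_true, Bool.true_eq_false, if_false] at h1 h2
    have := stepPerm_eq_mul_swap_of_straight (fun s hs => (hne s hs).symm) h2 h1
    rw [this, mul_assoc, Equiv.swap_mul_self, mul_one]
  · simp only [hh, if_true, Bool.false_eq_true, if_false] at h1 h2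
    exact stepPerm_eq_mul_swap_of_straight hne h1 h2

/-- Every edge of the cube merges two circles or splits a circle into two. -/
theorem IsEdge.circleOf_eq_iff (h : D.IsEdge r r' c) :
    D.circleOf r' (D.inOuter c) = D.circleOf r' (D.outInner c) ↔
      D.circleOf r (D.inOuter c) ≠ D.circleOf r (D.outInner c) := by
  classical
  rw [Ne, AnnularDiagram.circleOf_eq_iff (e := (D.piece c.1).index),
    AnnularDiagram.circleOf_eq_iff (e := (D.piece c.1).index), h.stepPerm_eq,
    Equiv.Perm.sameCycle_mul_swap_iff (inOuter_ne_outInner c)]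

/-- The circle `C` passes through the crossing `c`. -/
def Touches (c : D.Crossing) (C : D.Circle r) : Prop :=
  C = D.circleOf r (D.inOuter c) ∨ C = D.circleOf r (D.outInner c)

open Classical in
-- Along a cycle for `r'`, every step either stays on a circle of `r` or jumps from one of the
-- circles at `c` to the other. A walk that leaves its circle therefore starts and ends on circles
-- at `c`.
theorem circleOf_of_eq_mul_swap {e : ℕ}
    (h : D.stepPerm r' e = D.stepPerm r e * Equiv.swap (D.inOuter c) (D.outInner c))
    {a b : D.Point} (hab : D.circleOf r' a = D.circleOf r' b) :
    D.circleOf r b = D.circleOf r a ∨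
      Touches c (D.circleOf r a) ∧ Touches c (D.circleOf r b) := by
  obtain ⟨n, -, rfl⟩ := ((circleOf_eq_iff (e := e)).1 hab).exists_pow_eq'
  clear hab
  induction n with
  | zero => exact .inl rfl
  | succ n ih =>
    rw [pow_succ', Equiv.Perm.mul_apply]
    generalize (D.stepPerm r' e ^ n) a = b at ih ⊢
    rw [h, Equiv.Perm.mul_apply, circleOf_stepPerm]
    by_cases h1 : b = D.inOuter c
    · subst h1
      rw [Equiv.swap_apply_left]
      rcases ih with ih | ih
      · exact .inr ⟨.inl ih.symm, .inr rfl⟩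
      · exact .inr ⟨ih.1, .inr rfl⟩
    by_cases h2 : b = D.outInner c
    · subst h2
      rw [Equiv.swap_apply_right]
      rcases ih with ih | ih
      · exact .inr ⟨.inr ih.symm, .inl rfl⟩
      · exact .inr ⟨ih.1, .inl rfl⟩
    rwa [Equiv.swap_apply_of_ne_of_ne h1 h2]

theorem touches_of_circleOf_eq
    (h : ∀ {a b : D.Point}, D.circleOf r' a = D.circleOf r' b → D.circleOf r b = D.circleOf r a ∨
      Touches c (D.circleOf r a) ∧ Touches c (D.circleOf r b)) {a : D.Point}
    (ha : Touches c (D.circleOf r' a)) : Touches c (D.circleOf r a) := by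
  rcases ha with ha | ha <;> rcases h ha with h | h
  · exact .inl h.symm
  · exact h.1
  · exact .inr h.symm
  · exact h.1

theorem IsEdge.circleOf_eq_of_right (h : D.IsEdge r r' c) {a b : D.Point}
    (hab : D.circleOf r' a = D.circleOf r' b) :
    D.circleOf r b = D.circleOf r a ∨
      Touches c (D.circleOf r a) ∧ Touches c (D.circleOf r b) :=
  circleOf_of_eq_mul_swap h.stepPerm_eq hab

theorem IsEdge.circleOf_eq_of_left (h : D.IsEdge r r' c) {a b : D.Point}
    (hab : D.circleOf r a = D.circleOf r b) :
    D.circleOf r' b = D.circleOf r' a ∨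
      Touches c (D.circleOf r' a) ∧ Touches c (D.circleOf r' b) := by
  classical
  refine circleOf_of_eq_mul_swap (e := (D.piece c.1).index) ?_ hab
  rw [h.stepPerm_eq, mul_assoc, Equiv.swap_mul_self, mul_one]

theorem IsEdge.touches_iff (h : D.IsEdge r r' c) (a : D.Point) :
    Touches c (D.circleOf r' a) ↔ Touches c (D.circleOf r a) :=
  ⟨touches_of_circleOf_eq h.circleOf_eq_of_right,
    touches_of_circleOf_eq h.circleOf_eq_of_left⟩

end AnnularDiagram

/-! ### Products over the circles at and away from a crossing -/

namespace AnnularDiagram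

variable {D : AnnularDiagram} {r r' : D.Vertex} {c : D.Crossing}

open Classical in
theorem prod_touches_of_ne (F : D.Circle r → ℂ)
    (h : D.circleOf r (D.inOuter c) ≠ D.circleOf r (D.outInner c)) :
    ∏ C with Touches c C, F C
      = F (D.circleOf r (D.inOuter c)) * F (D.circleOf r (D.outInner c)) := by
  rw [← Finset.prod_pair h]
  refine Finset.prod_congr ?_ fun _ _ => rfl
  ext C
  simp only [Finset.mem_filter, Finset.mem_univ, true_and, Finset.mem_insert, Finset.mem_singleton]
  rfl

open Classical in
theorem prod_touches_of_eq (F : D.Circle r → ℂ)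
    (h : D.circleOf r (D.inOuter c) = D.circleOf r (D.outInner c)) :
    ∏ C with Touches c C, F C = F (D.circleOf r (D.inOuter c)) := by
  rw [← Finset.prod_singleton F (D.circleOf r (D.inOuter c))]
  refine Finset.prod_congr ?_ fun _ _ => rfl
  ext C
  simp [Touches, ← h]

open Classical in
-- Circles away from `c` are the same in both resolutions. They are matched through a chosen point
-- on each.
theorem prod_not_touches_eq {x y : D.Generator} (h : D.IsEdge x.1 y.1 c)
    (hxy : D.AgreeAway x y c) (φ : Bool → ℂ) :
    ∏ C with ¬ Touches c C, φ (x.2 C) = ∏ C with ¬ Touches c C, φ (y.2 C) := by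
  have hout : ∀ {r : D.Vertex} (C : D.Circle r), D.circleOf r (Quot.out C) = C :=
    fun C => Quot.out_eq C
  have hx : ∀ C : D.Circle x.1, ¬ Touches c C → ¬ Touches c (D.circleOf y.1 (Quot.out C)) :=
    fun C hC => by rwa [h.touches_iff, hout]
  have hy : ∀ C : D.Circle y.1, ¬ Touches c C → ¬ Touches c (D.circleOf x.1 (Quot.out C)) :=
    fun C hC => by rwa [← h.touches_iff, hout]
  refine Finset.prod_nbij' (fun C => D.circleOf y.1 (Quot.out C))
    (fun C => D.circleOf x.1 (Quot.out C)) ?_ ?_ ?_ ?_ ?_ <;>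
    simp only [Finset.mem_filter, Finset.mem_univ, true_and]
  · exact hx
  · exact hy
  · intro C hC
    rcases h.circleOf_eq_of_right (hout (D.circleOf y.1 (Quot.out C))) with h' | h'
    · rw [← h', hout]
    · rw [hout C] at h'
      exact absurd h'.2 hC
  · intro C hC
    rcases h.circleOf_eq_of_left (hout (D.circleOf x.1 (Quot.out C))) with h' | h'
    · rw [← h', hout]
    · rw [hout C] at h'
      exact absurd h'.2 hC
  · intro C hC
    have hm := hxy (Quot.out C)
    rw [hout, Generator.mark, Generator.mark, hout] at hm
    rw [hm (fun h => hC (.inl h)) fun h => hC (.inr h)]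

/-! ### The symmetry of the Lee complex -/

/-- The fourth root of unity by which a mark contributes to the symmetry. -/
noncomputable def markWeight (b : Bool) : ℂ := if b then Complex.I else -Complex.I

/-- The imaginary unit to the power of the quantum grading, up to a constant factor. -/
noncomputable def weight (x : D.Generator) : ℂ :=
  Complex.I ^ Nat.card {c : D.Crossing // x.1 c = true} * ∏ C, markWeight (x.2 C)

theorem IsEdge.card_eq (h : D.IsEdge r r' c) :
    Nat.card {c : D.Crossing // r' c = true} = Nat.card {c : D.Crossing // r c = true} + 1 := by
  classical
  simp only [Nat.card_eq_fintype_card, Fintype.card_subtype]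
  have : (Finset.univ.filter fun c' => r' c' = true)
      = insert c (Finset.univ.filter fun c' => r c' = true) := by
    ext c'
    by_cases hc : c' = c
    · subst hc
      simp [h.2.1]
    · simp [hc, h.2.2 c' hc]
  rw [this, Finset.card_insert_of_notMem (by simp [h.1])]

/-- The ordinary terms lower the sum of the marks by `1`, and Lee's terms raise it by `3`. With the
additional `1`-smoothing the exponent of `i` changes by `0` or `4`. -/
theorem weight_eq_of_saddleCoeff {x y : D.Generator} (h : D.IsEdge x.1 y.1 c)
    (hxy : D.AgreeAway x y c) (hs : D.saddleCoeff x y c ≠ 0) : weight x = weight y := by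
  classical
  have hiff := h.circleOf_eq_iff
  unfold weight
  rw [h.card_eq, pow_succ, mul_assoc,
    ← Finset.prod_filter_mul_prod_filter_not Finset.univ (Touches c) (fun C => markWeight (x.2 C)),
    ← Finset.prod_filter_mul_prod_filter_not Finset.univ (Touches c) (fun C => markWeight (y.2 C)),
    prod_not_touches_eq h hxy, ← mul_assoc Complex.I]
  congr 2
  unfold saddleCoeff at hs
  by_cases hx : D.circleOf x.1 (D.inOuter c) = D.circleOf x.1 (D.outInner c)
  · rw [if_neg (not_not.2 hx)] at hs
    rw [prod_touches_of_eq _ hx, prod_touches_of_ne _ fun hy => hiff.1 hy hx]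
    change markWeight (x.mark _) = _ * (markWeight (y.mark _) * markWeight (y.mark _))
    revert hs
    cases x.mark (D.inOuter c) <;> cases y.mark (D.inOuter c) <;> cases y.mark (D.outInner c) <;>
      simp [comulCoeff, markWeight]
  · rw [if_pos hx] at hs
    rw [prod_touches_of_ne _ hx, prod_touches_of_eq _ (hiff.2 hx)]
    change markWeight (x.mark _) * markWeight (x.mark _) = _ * markWeight (y.mark _)
    revert hs
    cases x.mark (D.inOuter c) <;> cases x.mark (D.outInner c) <;> cases y.mark (D.inOuter c) <;>
      simp [mulCoeff, markWeight]

theorem weight_eq_of_diffCoeff {x y : D.Generator} (h : D.diffCoeff x y ≠ 0) :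
    weight x = weight y := by
  obtain ⟨c, -, hc⟩ := Finset.exists_ne_zero_of_sum_ne_zero h
  split_ifs at hc with hxy
  · exact weight_eq_of_saddleCoeff hxy.1 hxy.2 (right_ne_zero_of_mul hc)
  · exact absurd rfl hc

variable (D) in
/-- The automorphism of the Lee complex that multiplies every generator by its weight. -/
noncomputable def twist : D.Chain →ₗ[ℂ] D.Chain :=
  LinearMap.pi fun x => weight x • LinearMap.proj x

theorem twist_apply (z : D.Chain) (x : D.Generator) : D.twist z x = weight x * z x := rfl

theorem leeDiff_apply (z : D.Chain) (y : D.Generator) :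
    D.leeDiff z y = ∑ x, D.diffCoeff x y * z x := rfl

theorem leeDiff_twist (z : D.Chain) : D.leeDiff (D.twist z) = D.twist (D.leeDiff z) := by
  funext y
  rw [twist_apply, leeDiff_apply, leeDiff_apply, Finset.mul_sum]
  refine Finset.sum_congr rfl fun x _ => ?_
  by_cases h : D.diffCoeff x y = 0
  · simp [h]
  · rw [twist_apply, weight_eq_of_diffCoeff h]
    ring

theorem twist_vec (x : D.Generator) : D.twist x.vec = weight x • x.vec := by
  classical
  funext y
  rw [twist_apply, Pi.smul_apply, Generator.vec, smul_eq_mul]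
  by_cases h : y = x
  · rw [h]
  · simp [h]

/-- The chain in which every circle of a resolution is labelled by `a` or `b`. -/
noncomputable def labelledChain (r : D.Vertex) (l : D.Circle r → Bool) : D.Chain :=
  ∑ m : D.Circle r → Bool, (∏ C, labelCoeff (l C) (m C)) • Generator.vec (⟨r, m⟩ : D.Generator)

/-- The oriented resolutions of `o` and `o.reverse` agree only propositionally, so their labels,
which live on different types, are compared at points. -/
theorem labelledChain_congr (h : r = r') {l : D.Circle r → Bool} {l' : D.Circle r' → Bool}
    (hl : ∀ a, l (D.circleOf r a) = l' (D.circleOf r' a)) :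
    labelledChain r l = labelledChain r' l' := by
  subst h
  congr 1
  funext C
  induction C using Quot.ind
  exact hl _

/-- On one circle, `v₋ ± v₊` becomes `-i (v₋ ∓ v₊)`. Each circle contributes a factor `-i` to `ζ`.
-/
theorem twist_labelledChain (l : D.Circle r → Bool) : ∃ ζ : ℂ, ζ ≠ 0 ∧
    D.twist (labelledChain r l) = ζ • labelledChain r fun C => !l C := by
  refine ⟨Complex.I ^ Nat.card {c : D.Crossing // r c = true} * ∏ _C : D.Circle r, -Complex.I,
    mul_ne_zero (pow_ne_zero _ Complex.I_ne_zero)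
      (Finset.prod_ne_zero_iff.2 fun _ _ => neg_ne_zero.2 Complex.I_ne_zero), ?_⟩
  simp only [labelledChain, map_sum, map_smul, twist_vec, Finset.smul_sum, smul_smul]
  refine Finset.sum_congr rfl fun m _ => ?_
  congr 1
  rw [weight, mul_left_comm, mul_assoc, ← Finset.prod_mul_distrib, ← Finset.prod_mul_distrib]
  congr 1
  refine Finset.prod_congr rfl fun C _ => ?_
  change labelCoeff (l C) (m C) * markWeight (m C) = _
  cases l C <;> cases m C <;> simp [labelCoeff, markWeight]

theorem Orientation.isPositive_reverse (o : D.Orientation) :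
    o.reverse.isPositive = o.isPositive := by
  funext c
  simp only [isPositive, reverse]
  cases o.dir (D.inOuter c) <;> cases o.dir (D.inInner c) <;> rfl

/-- Reversal keeps all crossing signs, hence the oriented resolution, and changes the parity of
every depth, hence exchanges `a` and `b` on every circle. -/
theorem Orientation.twist_canonicalChain (o : D.Orientation) : ∃ ζ : ℂ, ζ ≠ 0 ∧
    D.twist o.canonicalChain = ζ • o.reverse.canonicalChain := by
  obtain ⟨ζ, hζ, h⟩ := twist_labelledChain o.isA
  refine ⟨ζ, hζ, h.trans (congrArg _ (labelledChain_congr ?_ fun a => ?_))⟩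
  · unfold vertex
    rw [o.isPositive_reverse]
  · change (!decide (Even ((a.2 : ℕ) + if o.dir a then 1 else 0)))
      = decide (Even ((a.2 : ℕ) + if !o.dir a then 1 else 0))
    cases o.dir a <;> simp [Nat.even_add_one, -Nat.not_even_iff_odd]

/-! ### The canonical classes do not vanish -/

theorem labelledChain_apply (l : D.Circle r → Bool) (m : D.Circle r → Bool) :
    labelledChain r l ⟨r, m⟩ = ∏ C, labelCoeff (l C) (m C) := by
  classical
  simp only [labelledChain, Finset.sum_apply, Pi.smul_apply, Generator.vec, smul_eq_mul]
  rw [Finset.sum_eq_single m]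
  · simp
  · intro m' _ hm
    rw [Pi.single_eq_of_ne, mul_zero]
    intro h
    exact hm (eq_of_heq (Sigma.mk.inj h).2).symm
  · simp

/-- The pairing with a labelled chain. -/
noncomputable def labelledPairing (r : D.Vertex) (l : D.Circle r → Bool) : D.Chain →ₗ[ℂ] ℂ :=
  ∑ m : D.Circle r → Bool,
    (∏ C, labelCoeff (l C) (m C)) • LinearMap.proj (⟨r, m⟩ : D.Generator)

theorem labelledPairing_apply (l : D.Circle r → Bool) (z : D.Chain) :
    labelledPairing r l z = ∑ m : D.Circle r → Bool, (∏ C, labelCoeff (l C) (m C)) * z ⟨r, m⟩ := by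
  simp [labelledPairing]

/-- The coefficients are `±1` and the pairing is bilinear, so the value is the number of markings.
-/
theorem labelledPairing_self (l : D.Circle r → Bool) :
    labelledPairing r l (labelledChain r l) ≠ 0 := by
  have h : ∀ m : D.Circle r → Bool,
      (∏ C, labelCoeff (l C) (m C)) * labelledChain r l ⟨r, m⟩ = 1 := by
    intro m
    rw [labelledChain_apply, ← Finset.prod_mul_distrib]
    refine Finset.prod_eq_one fun C _ => ?_
    cases l C <;> cases m C <;> simp [labelCoeff]
  rw [labelledPairing_apply, Finset.sum_congr rfl fun m _ => h m]
  simp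

open Classical in
/-- Change the marks of the circles at a crossing. -/
noncomputable def flipMarks (c : D.Crossing) (m : D.Circle r → Bool) : D.Circle r → Bool :=
  fun C => if Touches c C then !m C else m C

theorem flipMarks_of_touches (m : D.Circle r → Bool) {C : D.Circle r} (hC : Touches c C) :
    flipMarks c m C = !m C :=
  if_pos hC

theorem flipMarks_involutive : Function.Involutive (flipMarks (r := r) c) := by
  intro m
  funext C
  unfold flipMarks
  split_ifs <;> simp

/-- Exactly one of the two circles is labelled `b`, and only for `b` does flipping the mark change
the sign. -/
theorem prod_labelCoeff_flipMarks {l : D.Circle r → Bool}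
    (hl : l (D.circleOf r (D.inOuter c)) = !l (D.circleOf r (D.outInner c)))
    (m : D.Circle r → Bool) :
    ∏ C, labelCoeff (l C) (flipMarks c m C) = -∏ C, labelCoeff (l C) (m C) := by
  classical
  have hne : D.circleOf r (D.inOuter c) ≠ D.circleOf r (D.outInner c) := by
    intro h
    simp [h] at hl
  rw [← Finset.prod_filter_mul_prod_filter_not Finset.univ (Touches c),
    ← Finset.prod_filter_mul_prod_filter_not Finset.univ (Touches c)
      (fun C => labelCoeff (l C) (m C)),
    prod_touches_of_ne _ hne, prod_touches_of_ne _ hne, ← neg_mul]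
  congr 1
  · rw [flipMarks_of_touches _ (.inl rfl), flipMarks_of_touches _ (.inr rfl), hl]
    cases l (D.circleOf r (D.outInner c)) <;> cases m (D.circleOf r (D.inOuter c)) <;>
      cases m (D.circleOf r (D.outInner c)) <;> simp [labelCoeff]
  · refine Finset.prod_congr rfl fun C hC => ?_
    rw [flipMarks, if_neg (Finset.mem_filter.1 hC).2]

/-- Opposite labels at every crossing make each edge into `r` a split. The coproduct coefficients
are invariant under flipping both resulting marks, whereas the pairing changes sign, so the
contributions cancel. -/
theorem labelledPairing_leeDiff_vec {l : D.Circle r → Bool}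
    (hl : ∀ c, l (D.circleOf r (D.inOuter c)) = !l (D.circleOf r (D.outInner c)))
    (x : D.Generator) : labelledPairing r l (D.leeDiff x.vec) = 0 := by
  classical
  simp only [labelledPairing_apply, leeDiff_vec, diffCoeff, Finset.mul_sum]
  rw [Finset.sum_comm]
  refine Finset.sum_eq_zero fun c _ => ?_
  have hne : D.circleOf r (D.inOuter c) ≠ D.circleOf r (D.outInner c) := by
    intro h
    have := hl c
    simp [h] at this
  by_cases he : D.IsEdge x.1 r c
  swap
  · refine Finset.sum_eq_zero fun m _ => ?_
    rw [if_neg fun h => he h.1, mul_zero]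
  have hx : D.circleOf x.1 (D.inOuter c) = D.circleOf x.1 (D.outInner c) := by
    by_contra h
    exact hne (he.circleOf_eq_iff.2 h)
  have hterm : ∀ m, (if D.IsEdge x.1 r c ∧ D.AgreeAway x ⟨r, flipMarks c m⟩ c then
      D.edgeSign x.1 c * D.saddleCoeff x ⟨r, flipMarks c m⟩ c else 0)
      = if D.IsEdge x.1 r c ∧ D.AgreeAway x ⟨r, m⟩ c then
        D.edgeSign x.1 c * D.saddleCoeff x ⟨r, m⟩ c else 0 := by
    intro m
    have h1 : D.AgreeAway x ⟨r, flipMarks c m⟩ c ↔ D.AgreeAway x ⟨r, m⟩ c := by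
      refine forall_congr' fun a => forall_congr' fun h1 => forall_congr' fun h2 => ?_
      have : Generator.mark ⟨r, flipMarks c m⟩ a = Generator.mark ⟨r, m⟩ a :=
        if_neg ((he.touches_iff a).not.2 (not_or.2 ⟨h1, h2⟩))
      rw [this]
    have h2 : D.saddleCoeff x ⟨r, flipMarks c m⟩ c = D.saddleCoeff x ⟨r, m⟩ c := by
      unfold saddleCoeff
      rw [if_neg (not_not.2 hx), if_neg (not_not.2 hx)]
      change comulCoeff _ (flipMarks c m (D.circleOf r (D.inOuter c)))
          (flipMarks c m (D.circleOf r (D.outInner c)))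
        = comulCoeff _ (m (D.circleOf r (D.inOuter c))) (m (D.circleOf r (D.outInner c)))
      rw [flipMarks_of_touches _ (.inl rfl), flipMarks_of_touches _ (.inr rfl)]
      cases x.mark (D.inOuter c) <;> cases m (D.circleOf r (D.inOuter c)) <;>
        cases m (D.circleOf r (D.outInner c)) <;> rfl
    rw [h1, h2]
  refine self_eq_neg.mp ((Equiv.sum_comp (flipMarks_involutive (c := c)).toPerm _).symm.trans ?_)
  rw [← Finset.sum_neg_distrib]
  refine Finset.sum_congr rfl fun m _ => ?_
  rw [← neg_mul, ← prod_labelCoeff_flipMarks (hl c) m, ← hterm m]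
  rfl

theorem sum_smul_vec (z : D.Chain) : ∑ x, z x • Generator.vec x = z := by
  classical
  funext y
  simp [Generator.vec, Finset.sum_apply, Pi.single_apply]

theorem Orientation.canonicalChain_notMem_range (o : D.Orientation) :
    o.canonicalChain ∉ LinearMap.range D.leeDiff := by
  rintro ⟨z, hz⟩
  refine labelledPairing_self o.isA ?_
  change labelledPairing _ _ o.canonicalChain = 0
  rw [← hz, ← sum_smul_vec z]
  simp only [map_sum, map_smul, labelledPairing_leeDiff_vec o.isA_inOuter, smul_zero,
    Finset.sum_const_zero]

theorem homologyClass_eq_iff {z z' : LinearMap.ker D.leeDiff} :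
    D.homologyClass z = D.homologyClass z' ↔ (z : D.Chain) - z' ∈ LinearMap.range D.leeDiff :=
  Submodule.Quotient.eq _

theorem Orientation.canonicalClass_ne_zero (o : D.Orientation) : o.canonicalClass ≠ 0 := by
  intro h
  rw [canonicalClass, ← map_zero D.homologyClass, homologyClass_eq_iff] at h
  exact o.canonicalChain_notMem_range (by simpa using h)

/-! ### The filtration -/

namespace Orientation

variable (o : D.Orientation) {t : ℝ}

theorem mem_filtration {a : ℝ} {z : D.Chain} :
    z ∈ o.filtration t a ↔ ∀ x, z x ≠ 0 → a ≤ o.jtGrading t x := by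
  classical
  have hvec : (Generator.vec : D.Generator → D.Chain) = Pi.basisFun ℂ D.Generator := by
    funext x
    simp [Generator.vec]
  rw [filtration, hvec, Module.Basis.mem_span_image]
  simp [Set.subset_def]

/-- The grading is the minimum over the support. Being the value at some generator, it ranges over a
finite set, so the supremum over representatives of a class is attained. -/
theorem exists_chainGrading_eq {z : D.Chain} (hz : z ≠ 0) :
    ∃ x, o.chainGrading t z = o.jtGrading t x ∧
    ∀ a, z ∈ o.filtration t a ↔ a ≤ o.chainGrading t z := by
  classical
  obtain ⟨x₀, hx₀⟩ := Function.ne_iff.1 hz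
  obtain ⟨x, hx, hmin⟩ := Finset.exists_min_image (Finset.univ.filter fun x => z x ≠ 0)
    (o.jtGrading t) ⟨x₀, by simpa using hx₀⟩
  simp only [Finset.mem_filter, Finset.mem_univ, true_and] at hx hmin
  have hiff : ∀ a, z ∈ o.filtration t a ↔ a ≤ o.jtGrading t x := fun a =>
    o.mem_filtration.trans ⟨fun h => h x hx, fun h y hy => h.trans (hmin y hy)⟩
  have hgr : o.chainGrading t z = o.jtGrading t x := by
    rw [chainGrading, show {a | z ∈ o.filtration t a} = Set.Iic (o.jtGrading t x) from Set.ext hiff,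
      csSup_Iic]
  exact ⟨x, hgr, by rwa [hgr]⟩

theorem ne_zero_of_homologyClass {η : D.LeeHomology} (hη : η ≠ 0) {z : LinearMap.ker D.leeDiff}
    (hz : D.homologyClass z = η) : (z : D.Chain) ≠ 0 := by
  rintro h
  obtain rfl : z = 0 := Subtype.ext h
  exact hη (hz.symm.trans (map_zero _))

/-- The grading of a homology class is attained by a representative. -/
theorem le_homologyGrading_iff {η : D.LeeHomology} (hη : η ≠ 0) {a : ℝ} :
    a ≤ o.homologyGrading t η ↔
      ∃ z : LinearMap.ker D.leeDiff, D.homologyClass z = η ∧ (z : D.Chain) ∈ o.filtration t a := by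
  set S := {g : ℝ | ∃ z : LinearMap.ker D.leeDiff,
    D.homologyClass z = η ∧ o.chainGrading t z = g} with hS
  have hfin : S.Finite := by
    refine (Set.finite_range (o.jtGrading t)).subset ?_
    rintro _ ⟨z, hz, rfl⟩
    obtain ⟨x, hx, -⟩ := o.exists_chainGrading_eq (t := t) (ne_zero_of_homologyClass hη hz)
    exact ⟨x, hx.symm⟩
  have hne : S.Nonempty := by
    obtain ⟨z, hz⟩ := Submodule.mkQ_surjective _ η
    exact ⟨_, z, hz, rfl⟩
  constructor
  · intro h
    obtain ⟨z, hz, hg⟩ := hne.csSup_mem hfin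
    obtain ⟨-, -, hx⟩ := o.exists_chainGrading_eq (t := t) (ne_zero_of_homologyClass hη hz)
    exact ⟨z, hz, (hx a).2 (h.trans hg.ge)⟩
  · rintro ⟨z, hz, ha⟩
    obtain ⟨-, -, hx⟩ := o.exists_chainGrading_eq (t := t) (ne_zero_of_homologyClass hη hz)
    exact ((hx a).1 ha).trans (le_csSup hfin.bddAbove ⟨z, hz, rfl⟩)

/-- A diagonal map cannot enlarge the support of a chain. -/
theorem twist_mem_filtration {a : ℝ} {z : D.Chain} (hz : z ∈ o.filtration t a) :
    D.twist z ∈ o.filtration t a := by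
  rw [mem_filtration] at hz ⊢
  exact fun x hx => hz x (right_ne_zero_of_mul (twist_apply z x ▸ hx))

theorem homologyGrading_reverse : o.reverse.homologyGrading t = o.homologyGrading t := by
  have h : o.reverse.jtGrading t = o.jtGrading t := by
    funext x
    simp only [jtGrading, jGrading, nPos, nNeg, o.isPositive_reverse]
  funext η
  simp only [homologyGrading, chainGrading, filtration, h]

/-- An optimal representative of the class of `o`, twisted and divided by `ζ`, represents the class
of the reverse in the same filtration step. -/
theorem homologyGrading_canonicalClass_le :
    o.homologyGrading t o.canonicalClass ≤ o.homologyGrading t o.reverse.canonicalClass := by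
  obtain ⟨z, hz, ha⟩ := (o.le_homologyGrading_iff o.canonicalClass_ne_zero).1 le_rfl
  obtain ⟨ζ, hζ, h⟩ := o.twist_canonicalChain
  rw [o.le_homologyGrading_iff o.reverse.canonicalClass_ne_zero]
  refine ⟨⟨ζ⁻¹ • D.twist z, ?_⟩, ?_, Submodule.smul_mem _ _ (o.twist_mem_filtration ha)⟩
  · rw [LinearMap.mem_ker, map_smul, leeDiff_twist, LinearMap.mem_ker.1 z.2, map_zero, smul_zero]
  · rw [canonicalClass, homologyClass_eq_iff] at hz ⊢
    obtain ⟨w, hw⟩ := hz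
    refine ⟨ζ⁻¹ • D.twist w, ?_⟩
    rw [map_smul, leeDiff_twist, hw, map_sub, h, smul_sub, inv_smul_smul₀ hζ]

theorem reverse_reverse : o.reverse.reverse = o := by
  cases o
  simp [reverse]

theorem annularRasmussen_reverse : o.reverse.annularRasmussen t = o.annularRasmussen t := by
  -- The inequality for `o.reverse` is the converse one, since reversing twice gives `o` and both
  -- orientations define the same gradings.
  have h := o.reverse.homologyGrading_canonicalClass_le (t := t)
  rw [o.reverse_reverse, o.homologyGrading_reverse] at h
  rw [annularRasmussen, annularRasmussen, o.homologyGrading_reverse]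
  exact h.antisymm o.homologyGrading_canonicalClass_le

end Orientation

end AnnularDiagram

/-! ### The main theorem -/

theorem lemma5p4 (D : AnnularDiagram) (o : D.Orientation) (t : ℝ) (ht : t ∈ Set.Icc (0 : ℝ) 2) :
    o.canonicalClass ≠ 0 ∧ o.reverse.canonicalClass ≠ 0 ∧
    o.annularRasmussen t = o.reverse.annularRasmussen t ∧
    IsLeast {g : ℝ | ∃ η ∈ Submodule.span ℂ {o.canonicalClass, o.reverse.canonicalClass},
      η ≠ 0 ∧ o.homologyGrading t η = g} (o.annularRasmussen t) := by
  refine ⟨o.canonicalClass_ne_zero, o.reverse.canonicalClass_ne_zero,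
    o.annularRasmussen_reverse.symm,
    ⟨o.canonicalClass, Submodule.subset_span (.inl rfl), o.canonicalClass_ne_zero, rfl⟩, ?_⟩
  rintro _ ⟨η, hspan, hη, rfl⟩
  obtain ⟨α, β, rfl⟩ := Submodule.mem_span_pair.1 hspan
  obtain ⟨z, hz, ha⟩ := (o.le_homologyGrading_iff o.canonicalClass_ne_zero).1
    (le_refl (o.annularRasmussen t))
  obtain ⟨z', hz', ha'⟩ := (o.le_homologyGrading_iff o.reverse.canonicalClass_ne_zero
    (a := o.annularRasmussen t)).1 o.homologyGrading_canonicalClass_le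
  rw [o.le_homologyGrading_iff hη]
  -- Both representatives lie in the filtration step at `d_t`, and so does their combination, which
  -- represents `η`.
  refine ⟨α • z + β • z', by rw [map_add, map_smul, map_smul, hz, hz'], ?_⟩
  exact Submodule.add_mem _ (Submodule.smul_mem _ _ ha) (Submodule.smul_mem _ _ ha')
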